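/- Let $1\le m\le n$ be integers, let $\log$ denote the logarithm to base $2$, and let $X^n=(X_1,\ldots,X_n)$ be a random vector in $\mathbb{R}^n$ with a log-concave probability density function $f$ with respect to Lebesgue measure, i.e. $x\mapsto\log f(x)\in[-\infty,\infty)$ is concave on $\mathbb{R}^n$. Write $X^m=(X_1,\ldots,X_m)$ and $X_{m+1}^n=(X_{m+1},\ldots,X_n)$, and let $$h(X_{m+1}^n\,|\,X^m)=\mathbb{E}\bigl[-\log f_{X_{m+1}^n|X^m}(X_{m+1}^n\,|\,X^m)\bigr]$$ be the conditional differential entropy in bits, where $f_{X_{m+1}^n|X^m}$ is the conditional density, i.e. the joint density divided by the density of $X^m$. Then $f$ is bounded, the function $x^m\mapsto\sup_{\tilde x\in\mathbb{R}^{n-m}}f(x^m,\tilde x)$ is integrable on $\mathbb{R}^m$ with positive integral, the expectation defining $h(X_{m+1}^n\,|\,X^m)$ converges absolutely, and $$0\;\le\;h(X_{m+1}^n\,|\,X^m)+\log\Bigl(\int_{\mathbb{R}^m}\sup_{\tilde x\in\mathbb{R}^{n-m}}f(x^m,\tilde x)\,dx^m\Bigr)\;\le\;n\log e+\log\binom{n}{m}.$$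 -/

import Mathlib

open MeasureTheory

noncomputable section

namespace LogConcaveEntropy

/-- A nonnegative function `f` is log-concave when `x ↦ log f(x) ∈ [-∞, ∞)` is concave, i.e. when
the set where `f` is positive is convex and `log f` is concave on that set
(`ConcaveOn` includes the convexity of the set). -/
def LogConcave {n : ℕ} (f : (Fin n → ℝ) → ℝ) : Prop :=
  (∀ x, 0 ≤ f x) ∧ ConcaveOn ℝ {x | 0 < f x} (fun x => Real.logb 2 (f x))

/-- `f` is a probability density function, with respect to Lebesgue measure, of the random
vector `X` under the probability measure `P`. -/
structure IsPDFOf {Ω : Type*} [MeasurableSpace Ω] {n : ℕ}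
    (f : (Fin n → ℝ) → ℝ) (X : Ω → Fin n → ℝ) (P : Measure Ω) : Prop where
  aemeasurable_vector : AEMeasurable X P
  aemeasurable_density : AEMeasurable f volume
  nonneg : ∀ x, 0 ≤ f x
  map_eq : P.map X = (volume : Measure (Fin n → ℝ)).withDensity (fun x => ENNReal.ofReal (f x))

/-- The first `m` coordinates `x^m` of `x ∈ ℝ^n`. -/
def head {m n : ℕ} (h : m ≤ n) (x : Fin n → ℝ) : Fin m → ℝ :=
  fun i => x (Fin.castLE h i)

/-- The last `n - m` coordinates `x_{m+1}^n` of `x ∈ ℝ^n`. -/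
def tail (m : ℕ) {n : ℕ} (x : Fin n → ℝ) : Fin (n - m) → ℝ :=
  fun j => x ⟨m + j, by omega⟩

/-- The vector `(x, y) ∈ ℝ^n` whose first `m` coordinates are `x` and whose other coordinates
are `y`. -/
def join {m n : ℕ} (x : Fin m → ℝ) (y : Fin (n - m) → ℝ) : Fin n → ℝ :=
  fun i => if h : (i : ℕ) < m then x ⟨i, h⟩ else y ⟨(i : ℕ) - m, by omega⟩

/-- The conditional density `f_{Y|X}(y | x) = f_{X,Y}(x, y) / f_X(x)`. -/
def condDensity {Ω : Type*} [MeasurableSpace Ω] {k m : ℕ}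
    (Y : Ω → Fin k → ℝ) (X : Ω → Fin m → ℝ) (P : Measure Ω)
    (y : Fin k → ℝ) (x : Fin m → ℝ) : ℝ :=
  (pdf (fun ω => (X ω, Y ω)) P volume (x, y)).toReal / (pdf X P volume x).toReal

/-- The conditional differential entropy, in bits, `h(Y | X) = E[-log f_{Y|X}(Y | X)]`. -/
def condDiffEntropy {Ω : Type*} [MeasurableSpace Ω] {k m : ℕ}
    (Y : Ω → Fin k → ℝ) (X : Ω → Fin m → ℝ) (P : Measure Ω) : ℝ :=
  ∫ ω, -Real.logb 2 (condDensity Y X P (Y ω) (X ω)) ∂P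

/-- The function `x^m ↦ sup_{x̃} f(x^m, x̃)`, the supremum over `x̃ ∈ ℝ^{n-m}`. -/
def supMarginal (m : ℕ) {n : ℕ} (f : (Fin n → ℝ) → ℝ) (x : Fin m → ℝ) : ℝ :=
  ⨆ y : Fin (n - m) → ℝ, f (join x y)

end LogConcaveEntropy

end

namespace LogConcaveEntropy

open Set Module
open scoped ENNReal NNReal Pointwise Nat

/-! ### Rogers–Shephard inequalities for convex sets and quasi-concave functions. -/

section RogersShephard

/-! Let `G` be the density of the head, `M x` the supremum of `f` over the fibre at `x`, `J = ∫ M`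
and `B = sup f`.

Lower bound: the conditional density is at most `M / G`, so the entropy plus `log J` is at least
`E[-log (M / (J G))]`. This is nonnegative by `log s ≤ s - 1`, since `E[M / G] ≤ J`.

Upper bound: two inequalities are combined pointwise. The functional Rogers–Shephard inequality
`lintegral_iSup_mul_lintegral_section_le` gives `J * G x ≤ choose n m * B` for every `x`, so `-log
(f / G) ≤ log (B / f) + log (choose n m) - log J`. The bound `IsLogConcave.lintegral_mul_log_le`
gives `E[log (B / f)] ≤ n` in nats.

The functional inequality is integrated from the one for convex sets, level by level, with
Chebyshev's inequality for monotone functions. The set version compares the fibres along segments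
from a base point, and its binomial coefficient is the inverse of a Beta integral. -/

theorem integral_pow_mul_one_sub_pow (m k : ℕ) :
    ∫ u in (0 : ℝ)..1, u ^ k * (1 - u) ^ m = (k ! * m ! : ℝ) / (k + m + 1)! := by
  induction m generalizing k with
  | zero =>
    simp only [pow_zero, mul_one, integral_pow, Nat.factorial_zero, Nat.cast_one, add_zero,
      Nat.factorial_succ]
    push_cast
    field_simp
    simp
  | succ m ih =>
    have h := intervalIntegral.integral_mul_deriv_eq_deriv_mul (a := 0) (b := 1)
      (u := fun u : ℝ => (1 - u) ^ (m + 1)) (u' := fun u => -((m + 1) * (1 - u) ^ m))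
      (v := fun u : ℝ => u ^ (k + 1) / (k + 1)) (v' := fun u => u ^ k)
      (fun u _ => by
        have := ((hasDerivAt_id u).const_sub 1).pow (m + 1)
        convert this using 1
        · ext; simp
        · simp)
      (fun u _ => by
        have := (hasDerivAt_pow (k + 1) u).div_const (k + 1 : ℝ)
        convert this using 1
        push_cast
        field_simp)
      (Continuous.intervalIntegrable (by fun_prop) _ _)
      (Continuous.intervalIntegrable (by fun_prop) _ _)
    have h2 : ∫ u in (0 : ℝ)..1, -((m + 1 : ℝ) * (1 - u) ^ m) * (u ^ (k + 1) / (k + 1))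
        = -((m + 1 : ℝ) / (k + 1)) * ∫ u in (0 : ℝ)..1, u ^ (k + 1) * (1 - u) ^ m := by
      rw [← intervalIntegral.integral_const_mul]
      congr 1 with u
      field_simp
    rw [h2, ih] at h
    simp_rw [mul_comm (_ ^ k)]
    rw [h, show k + 1 + m + 1 = k + (m + 1) + 1 by ring, Nat.factorial_succ k,
      Nat.factorial_succ m]
    push_cast
    field_simp
    simp

/-- Chebyshev's integral inequality: integrate `(a u - a v) * (b u - b v) ≥ 0` over all pairs `(u,
v)`. The products are kept on two sides because subtraction in `ℝ≥0∞` is truncated. -/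
theorem lintegral_mul_lintegral_le_of_antitone {μ : Measure ℝ} [SFinite μ] {a b : ℝ → ℝ≥0∞}
    (ha : Antitone a) (hb : Antitone b) :
    (∫⁻ u, a u ∂μ) * (∫⁻ u, b u ∂μ) ≤ μ univ * ∫⁻ u, a u * b u ∂μ := by
  have hpt (u v : ℝ) : a u * b v + b u * a v ≤ a u * b u + a v * b v := by
    wlog h : u ≤ v generalizing u v
    · calc a u * b v + b u * a v = a v * b u + b v * a u := by ring
        _ ≤ a v * b v + a u * b u := this v u (le_of_not_ge h)
        _ = a u * b u + a v * b v := add_comm _ _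
    obtain ⟨d, hd⟩ := le_iff_exists_add.1 (ha h)
    calc a u * b v + b u * a v = (a v * b v + b u * a v) + d * b v := by rw [hd]; ring
      _ ≤ (a v * b v + b u * a v) + d * b u := by gcongr; exact hb h
      _ = a u * b u + a v * b v := by rw [hd]; ring
  have ham := ha.measurable
  have hbm := hb.measurable
  have h1 : ∫⁻ u, ∫⁻ v, (a u * b v + b u * a v) ∂μ ∂μ
      = 2 * ((∫⁻ u, a u ∂μ) * (∫⁻ u, b u ∂μ)) := by
    have (u : ℝ) : ∫⁻ v, (a u * b v + b u * a v) ∂μ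
        = a u * (∫⁻ v, b v ∂μ) + b u * ∫⁻ v, a v ∂μ := by
      rw [lintegral_add_left (by fun_prop), lintegral_const_mul _ hbm, lintegral_const_mul _ ham]
    simp_rw [this]
    rw [lintegral_add_left (by fun_prop), lintegral_mul_const _ ham, lintegral_mul_const _ hbm]
    ring
  have h2 : ∫⁻ u, ∫⁻ v, (a u * b u + a v * b v) ∂μ ∂μ
      = 2 * (μ univ * ∫⁻ u, a u * b u ∂μ) := by
    have (u : ℝ) : ∫⁻ v, (a u * b u + a v * b v) ∂μ
        = a u * b u * μ univ + ∫⁻ v, a v * b v ∂μ := by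
      rw [lintegral_add_left (by fun_prop), lintegral_const]
    simp_rw [this]
    rw [lintegral_add_left (by fun_prop), lintegral_mul_const _ (by fun_prop), lintegral_const]
    ring
  have h3 : 2 * ((∫⁻ u, a u ∂μ) * (∫⁻ u, b u ∂μ)) ≤ 2 * (μ univ * ∫⁻ u, a u * b u ∂μ) := by
    rw [← h1, ← h2]
    exact lintegral_mono fun u => lintegral_mono fun v => hpt u v
  exact (ENNReal.mul_le_mul_iff_right (by simp) (by simp)).1 h3

variable {E F : Type*} [NormedAddCommGroup E] [NormedSpace ℝ E] [FiniteDimensional ℝ E]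
  [MeasurableSpace E] [BorelSpace E] [NormedAddCommGroup F] [NormedSpace ℝ F]
  [FiniteDimensional ℝ F] [MeasurableSpace F] [BorelSpace F]
  (μ : Measure E) [μ.IsAddHaarMeasure] (ν : Measure F) [ν.IsAddHaarMeasure]

/-- Convex sets are null-measurable for Haar measure. This supplies the measurability of fibre
suprema, whose superlevel sets are projections of convex sets. -/
theorem aemeasurable_of_convex_superlevel {f : E → ℝ} (hf : ∀ u, Convex ℝ {x | u < f x}) :
    AEMeasurable f μ := by
  have h : Measurable (fun x : NullMeasurableSpace E μ => f x) :=
    measurable_of_Ioi fun u => (hf u).nullMeasurableSet μ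
  exact NullMeasurable.aemeasurable h

theorem lintegral_Icc_natCast_mul_pow {k : ℕ} (hk : k ≠ 0) {w : ℝ} (hw : 0 ≤ w) :
    ∫⁻ u in Icc 0 w, ENNReal.ofReal (k * u ^ (k - 1)) = ENNReal.ofReal (w ^ k) := by
  rw [← ofReal_integral_eq_lintegral_ofReal, integral_Icc_eq_integral_Ioc,
    ← intervalIntegral.integral_of_le hw, intervalIntegral.integral_const_mul, integral_pow]
  · have : (k : ℝ) ≠ 0 := by exact_mod_cast hk
    have h1 : k - 1 + 1 = k := by omega
    have h2 : ((k - 1 : ℕ) : ℝ) + 1 = k := by exact_mod_cast h1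
    rw [h1, h2, zero_pow hk]
    field_simp
    simp
  · exact (Continuous.integrableOn_Icc (by fun_prop))
  · filter_upwards [ae_restrict_mem measurableSet_Icc] with u hu
    have := hu.1
    positivity

/-- This is `k * B(k, m + 1) = 1 / choose (m + k) k`, the source of the binomial coefficient in the
theorem. -/
theorem lintegral_beta {m k : ℕ} (hk : k ≠ 0) :
    (Nat.choose (m + k) k : ℝ≥0∞) *
      ∫⁻ u in Ico (0 : ℝ) 1, ENNReal.ofReal (k * u ^ (k - 1)) * ENNReal.ofReal ((1 - u) ^ m) = 1 := by
  obtain ⟨k, rfl⟩ := Nat.exists_eq_succ_of_ne_zero hk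
  have h0 : ∀ u ∈ Ico (0 : ℝ) 1, 0 ≤ ((k + 1 : ℕ) : ℝ) * u ^ k * (1 - u) ^ m := fun u hu => by
    have := hu.1
    have : 0 ≤ 1 - u := by linarith [hu.2]
    positivity
  have : ∫⁻ u in Ico (0 : ℝ) 1, ENNReal.ofReal ((k + 1 : ℕ) * u ^ k) * ENNReal.ofReal ((1 - u) ^ m)
      = ENNReal.ofReal ((k + 1) * ((k ! * m ! : ℝ) / (k + m + 1)!)) := by
    rw [← integral_pow_mul_one_sub_pow, ← intervalIntegral.integral_const_mul,
      intervalIntegral.integral_of_le zero_le_one, ← integral_Ico_eq_integral_Ioc,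
      ofReal_integral_eq_lintegral_ofReal]
    · refine setLIntegral_congr_fun measurableSet_Ico fun u hu => ?_
      have := hu.1
      rw [← ENNReal.ofReal_mul (by positivity)]
      push_cast
      ring_nf
    · exact (Continuous.integrableOn_Icc (by fun_prop)).mono_set Ico_subset_Icc_self
    · filter_upwards [ae_restrict_mem measurableSet_Ico] with u hu
      have := h0 u hu
      push_cast at this
      simpa [mul_assoc] using this
  simp only [Nat.succ_eq_add_one, Nat.add_sub_cancel]
  rw [this, ← ENNReal.ofReal_natCast, ← ENNReal.ofReal_mul (by positivity), ENNReal.ofReal_eq_one]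
  have h := Nat.add_choose_mul_factorial_mul_factorial m (k + 1)
  have h' : (m + (k+1)).choose (k+1) * (m ! * (k+1)!) = (k + m + 1)! := by
    rw [show k + m + 1 = m + (k+1) by ring, ← h]; ring
  have h3 : ((m + (k+1)).choose (k+1) : ℝ) * (m ! * ((k+1) * k !)) = (k + m + 1)! := by
    rw [← h', Nat.factorial_succ k]; push_cast; ring
  have : ((k + m + 1)! : ℝ) ≠ 0 := by positivity
  field_simp
  linarith

/-- If `h (t • z) ≥ c (1 - t) ^ k` for every `z ∈ A` and `t ∈ (0, 1]`, then the integral of `h` is at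
least `c * μ A / choose (dim E + k) k`. -/
theorem mul_measure_le_choose_mul_lintegral {A : Set E} (hA : NullMeasurableSet A μ)
    {h : E → ℝ≥0∞} {c : ℝ≥0∞} {k : ℕ}
    (H : ∀ t ∈ Ioc (0 : ℝ) 1, ∀ z ∈ A, c * ENNReal.ofReal ((1 - t) ^ k) ≤ h (t • z)) :
    c * μ A ≤ Nat.choose (finrank ℝ E + k) k * ∫⁻ z, h z ∂μ := by
  obtain ⟨A', hA'A, hA'm, hA'e⟩ := hA.exists_measurable_subset_ae_eq
  rw [← measure_congr hA'e]
  replace H : ∀ t ∈ Ioc (0 : ℝ) 1, ∀ z ∈ A', c * ENNReal.ofReal ((1 - t) ^ k) ≤ h (t • z) :=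
    fun t ht z hz => H t ht z (hA'A hz)
  clear hA'e hA'A hA A
  -- The weight `k * u ^ (k - 1)` used below vanishes for `k = 0`; there the hypothesis at `t = 1`
  -- already suffices.
  rcases eq_or_ne k 0 with rfl | hk
  · have h1 : ∀ z ∈ A', c ≤ h z := fun z hz => by simpa using H 1 (by simp) z hz
    calc c * μ A' = ∫⁻ z in A', c ∂μ := by simp
      _ ≤ ∫⁻ z in A', h z ∂μ := setLIntegral_mono' hA'm h1
      _ ≤ _ := by simpa using setLIntegral_le_lintegral _ _
  -- `c` may be infinite; a smaller, finite `c'` makes `u ↦ c' * u ^ k` continuous.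
  refine ENNReal.mul_le_of_forall_lt fun c' hc' a' ha' => (mul_le_mul' le_rfl ha'.le).trans ?_
  have hc'top : c' ≠ ∞ := hc'.ne_top
  -- With `t = 1 - u`, this is the set of pairs `(z, u)` with `z ∈ (1 - u) • A'`. The weight on it
  -- is integrated in both orders: over `u` first it is controlled by `h`, over `z` first it gives
  -- the Beta integral.
  let S : Set (E × ℝ) := {p | p.2 ∈ Ico (0 : ℝ) 1 ∧ (1 - p.2)⁻¹ • p.1 ∈ A'}
  have hS : MeasurableSet S := by
    refine (measurable_snd measurableSet_Ico).inter ?_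
    have : Measurable fun p : E × ℝ => (1 - p.2)⁻¹ • p.1 := by fun_prop
    exact this hA'm
  let g : E × ℝ → ℝ≥0∞ := S.indicator fun p => ENNReal.ofReal (k * p.2 ^ (k - 1))
  have hg : Measurable g := Measurable.indicator (by fun_prop) hS
  have key (z : E) : c' * ∫⁻ u, g (z, u) ≤ h z := by
    let T : Set ℝ := {u | (z, u) ∈ S}
    have hT : MeasurableSet T := measurable_prodMk_left hS
    have hgT : ∫⁻ u, g (z, u) = ∫⁻ u in T, ENNReal.ofReal (k * u ^ (k - 1)) := by
      rw [← lintegral_indicator hT]; rfl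
    rw [hgT]
    rcases T.eq_empty_or_nonempty with hTe | hTe
    · simp [hTe]
    have hbdd : BddAbove T := ⟨1, fun u hu => hu.1.2.le⟩
    have hTw : T ⊆ Icc 0 (sSup T) := fun u hu => ⟨hu.1.1, le_csSup hbdd hu⟩
    have hw : 0 ≤ sSup T := by
      obtain ⟨u, hu⟩ := hTe
      exact (hTw hu).1.trans (hTw hu).2
    have hle : ∀ u ∈ T, c' * ENNReal.ofReal (u ^ k) ≤ h z := fun u hu => by
      have hu1 : 0 < 1 - u := by linarith [hu.1.2]
      have := H (1 - u) ⟨hu1, by linarith [hu.1.1]⟩ _ hu.2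
      rw [smul_inv_smul₀ hu1.ne', sub_sub_cancel] at this
      exact (mul_le_mul' hc'.le le_rfl).trans this
    have hcont : Continuous fun u : ℝ => c' * ENNReal.ofReal (u ^ k) :=
      (ENNReal.continuous_const_mul hc'top).comp (ENNReal.continuous_ofReal.comp (by fun_prop))
    have hcl : IsClosed {u : ℝ | c' * ENNReal.ofReal (u ^ k) ≤ h z} :=
      isClosed_le hcont continuous_const
    -- `T` need not be an interval: it is enlarged to `[0, sSup T]`, and the bound on `h z` extends
    -- to `sSup T` by closedness.
    calc c' * ∫⁻ u in T, ENNReal.ofReal (k * u ^ (k - 1))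
        ≤ c' * ∫⁻ u in Icc 0 (sSup T), ENNReal.ofReal (k * u ^ (k - 1)) := by
          gcongr
      _ = c' * ENNReal.ofReal (sSup T ^ k) := by rw [lintegral_Icc_natCast_mul_pow hk hw]
      _ ≤ h z := closure_minimal hle hcl (csSup_mem_closure hTe hbdd)
  have slice (u : ℝ) : ∫⁻ z, g (z, u) ∂μ = (Ico (0 : ℝ) 1).indicator (fun u =>
      ENNReal.ofReal (k * u ^ (k - 1)) * ENNReal.ofReal ((1 - u) ^ finrank ℝ E)) u * μ A' := by
    by_cases hu : u ∈ Ico (0 : ℝ) 1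
    · have hu1 : 0 < 1 - u := by linarith [hu.2]
      have : (fun z => g (z, u)) = ((1 - u) • A').indicator
          fun _ => ENNReal.ofReal (k * u ^ (k - 1)) := by
        ext z
        by_cases hz : (1 - u)⁻¹ • z ∈ A'
        · rw [indicator_of_mem ((mem_smul_set_iff_inv_smul_mem₀ hu1.ne' _ _).2 hz)]
          exact indicator_of_mem (show (z, u) ∈ S from ⟨hu, hz⟩) _
        · rw [indicator_of_notMem (fun h => hz ((mem_smul_set_iff_inv_smul_mem₀ hu1.ne' _ _).1 h))]
          exact indicator_of_notMem (fun h => hz h.2) _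
      rw [this, lintegral_indicator_const (hA'm.const_smul₀ _), indicator_of_mem hu,
        Measure.addHaar_smul, abs_of_pos (by positivity)]
      ring
    · have : (fun z => g (z, u)) = 0 := by
        ext z
        exact indicator_of_notMem (fun h => hu h.1) _
      rw [this, indicator_of_notMem hu, zero_mul, Pi.zero_def, lintegral_zero]
  calc c' * μ A' = c' * ((Nat.choose (finrank ℝ E + k) k : ℝ≥0∞) *
      (∫⁻ u in Ico (0 : ℝ) 1, ENNReal.ofReal (k * u ^ (k - 1)) *
        ENNReal.ofReal ((1 - u) ^ finrank ℝ E)) * μ A') := by rw [lintegral_beta hk, one_mul]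
    _ = Nat.choose (finrank ℝ E + k) k * (c' * ∫⁻ u, ∫⁻ z, g (z, u) ∂μ) := by
        simp_rw [slice]
        rw [lintegral_mul_const _ (Measurable.indicator (by fun_prop) measurableSet_Ico),
          lintegral_indicator measurableSet_Ico]
        ring
    _ = Nat.choose (finrank ℝ E + k) k * (∫⁻ z, c' * (∫⁻ u, g (z, u)) ∂μ) := by
        rw [lintegral_lintegral_swap (f := fun (u : ℝ) (z : E) => g (z, u))
            (hg.comp measurable_swap).aemeasurable,
          lintegral_const_mul _ hg.lintegral_prod_right']
    _ ≤ _ := by gcongr with z; exact key z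

/-- **Rogers–Shephard inequality** for the sections and the projection of a convex set. -/
theorem measure_image_fst_mul_measure_section_le {K : Set (E × F)} (hK : Convex ℝ K) (x₀ : E) :
    μ (Prod.fst '' K) * ν {y | (x₀, y) ∈ K} ≤
      Nat.choose (finrank ℝ E + finrank ℝ F) (finrank ℝ F) * (μ.prod ν) K := by
  have hKn : NullMeasurableSet K (μ.prod ν) := hK.nullMeasurableSet _
  have hvol : (μ.prod ν) K = ∫⁻ z, ν {y | (x₀ + z, y) ∈ K} ∂μ := by
    rw [lintegral_add_left_eq_self (fun z => ν {y | (z, y) ∈ K})]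
    rw [← lintegral_indicator_one₀ hKn,
      lintegral_prod _ ((show AEMeasurable (1 : E × F → ℝ≥0∞) _ from aemeasurable_const).indicator₀ hKn)]
    refine lintegral_congr fun z => ?_
    have hsec : Convex ℝ {y | (z, y) ∈ K} := fun y hy y' hy' a b ha hb hab => by
      have := hK hy hy' ha hb hab
      simpa [← add_smul, hab] using this
    rw [← lintegral_indicator_one₀ (hsec.nullMeasurableSet ν)]
    rfl
  have hproj : Convex ℝ (Prod.fst '' K) := hK.linear_image (LinearMap.fst ℝ E F)
  let A : Set E := (fun z => x₀ + z) ⁻¹' (Prod.fst '' K)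
  have hA : Convex ℝ A := hproj.translate_preimage_right x₀
  have hμA : μ A = μ (Prod.fst '' K) := measure_preimage_add μ x₀ _
  rw [hvol, ← hμA, mul_comm]
  refine mul_measure_le_choose_mul_lintegral μ (hA.nullMeasurableSet μ) fun t ht z hz => ?_
  obtain ⟨⟨x, y₁⟩, hmem, hx⟩ := hz
  have hx : x = x₀ + z := hx
  subst hx
  -- Joining `(x₀ + z, y₁)` to the section over `x₀` puts a translated copy of that section, shrunk
  -- by `1 - t`, into the section over `x₀ + t • z`.
  have hsub : (t • y₁) +ᵥ ((1 - t) • {y | (x₀, y) ∈ K}) ⊆ {y | (x₀ + t • z, y) ∈ K} := by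
    rintro _ ⟨_, ⟨y, hy, rfl⟩, rfl⟩
    have := hK hmem hy ht.1.le (by linarith [ht.2] : 0 ≤ 1 - t) (by ring)
    have hx : t • (x₀ + z) + (1 - t) • x₀ = x₀ + t • z := by
      rw [smul_add, sub_smul, one_smul]; abel
    rw [Prod.smul_mk, Prod.smul_mk, Prod.mk_add_mk, hx] at this
    exact this
  refine le_trans (le_of_eq ?_) (measure_mono hsub)
  rw [measure_vadd, Measure.addHaar_smul, abs_of_nonneg (pow_nonneg (by linarith [ht.2]) _), mul_comm]

theorem lintegral_ofReal_eq_setLIntegral_Ioc {α : Type*} [MeasurableSpace α] (μ : Measure α)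
    {f : α → ℝ} {B : ℝ} (hB : 0 ≤ B) (hf0 : ∀ x, 0 ≤ f x)
    (hfB : ∀ x, f x ≤ B) (hf : AEMeasurable f μ) :
    ∫⁻ x, ENNReal.ofReal (f x) ∂μ = ∫⁻ u in Ioc 0 B, μ {x | u < f x} := by
  rw [lintegral_eq_lintegral_meas_lt μ (Filter.Eventually.of_forall hf0) hf,
    ← Ioc_union_Ioi_eq_Ioi hB, lintegral_union measurableSet_Ioi Ioc_disjoint_Ioi_same,
    setLIntegral_congr_fun (g := 0) measurableSet_Ioi]
  · simp
  · intro u hu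
    have : {x | u < f x} = ∅ := by
      ext x
      simpa using (hfB x).trans (le_of_lt hu)
    simp [this]

/-- Functional **Rogers–Shephard inequality** for quasi-concave functions. -/
theorem lintegral_iSup_mul_lintegral_section_le {f : E × F → ℝ} {B : ℝ}
    (hf : ∀ u, Convex ℝ {z | u < f z}) (hf0 : ∀ z, 0 ≤ f z) (hfB : ∀ z, f z ≤ B) (x₀ : E) :
    (∫⁻ x, ENNReal.ofReal (⨆ y, f (x, y)) ∂μ) * ∫⁻ y, ENNReal.ofReal (f (x₀, y)) ∂ν ≤
      Nat.choose (finrank ℝ E + finrank ℝ F) (finrank ℝ F) *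
        (ENNReal.ofReal B * ∫⁻ z, ENNReal.ofReal (f z) ∂μ.prod ν) := by
  have hB : 0 ≤ B := (hf0 0).trans (hfB 0)
  have hbdd (x : E) : BddAbove (range fun y => f (x, y)) := ⟨B, by rintro _ ⟨y, rfl⟩; exact hfB _⟩
  have hproj (u : ℝ) : {x | u < ⨆ y, f (x, y)} = Prod.fst '' {z | u < f z} := by
    ext x
    simp [lt_ciSup_iff (hbdd x)]
  have hsup (u : ℝ) : Convex ℝ {x | u < ⨆ y, f (x, y)} := by
    rw [hproj]
    exact (hf u).linear_image (LinearMap.fst ℝ E F)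
  have hsec (u : ℝ) : Convex ℝ {y | u < f (x₀, y)} := fun y hy y' hy' a b ha hb hab => by
    have := hf u hy hy' ha hb hab
    simpa [← add_smul, hab] using this
  rw [lintegral_ofReal_eq_setLIntegral_Ioc μ hB (fun x => (hf0 (x, 0)).trans (le_ciSup (hbdd x) 0))
      (fun x => ciSup_le fun y => hfB _) (aemeasurable_of_convex_superlevel μ hsup),
    lintegral_ofReal_eq_setLIntegral_Ioc ν hB (fun _ => hf0 _) (fun _ => hfB _)
      (aemeasurable_of_convex_superlevel ν hsec),
    lintegral_ofReal_eq_setLIntegral_Ioc _ hB hf0 hfB (aemeasurable_of_convex_superlevel _ hf)]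
  -- Both level-set measures decrease in `u`, so Chebyshev on `(0, B]` bounds the product of
  -- integrals by `B` times the integral of the product, to which the set inequality applies at each
  -- level.
  refine (lintegral_mul_lintegral_le_of_antitone
    (a := fun u => μ {x | u < ⨆ y, f (x, y)}) (b := fun u => ν {y | u < f (x₀, y)})
    (fun u v huv => measure_mono fun x (hx : v < _) => lt_of_le_of_lt huv hx)
    (fun u v huv => measure_mono fun x (hx : v < _) => lt_of_le_of_lt huv hx)).trans ?_
  simp only [MeasurableSet.univ, Measure.restrict_apply, univ_inter, Real.volume_Ioc, sub_zero]
  rw [mul_left_comm]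
  refine mul_le_mul' le_rfl ?_
  rw [← lintegral_const_mul' _ _ (by simp)]
  refine lintegral_mono fun u => ?_
  rw [hproj]
  exact measure_image_fst_mul_measure_section_le μ ν (hf u) x₀

end RogersShephard

/-! ### Boundedness and entropy of log-concave densities. -/

section LogConcaveFunctions

/-- Log-concavity in multiplicative form. -/
structure IsLogConcave {E : Type*} [AddCommGroup E] [Module ℝ E] (f : E → ℝ) : Prop where
  nonneg : ∀ x, 0 ≤ f x
  le_map : ∀ x y, ∀ a b : ℝ, 0 < a → 0 < b → a + b = 1 → f x ^ a * f y ^ b ≤ f (a • x + b • y)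

theorem LogConcave.isLogConcave {n : ℕ} {f : (Fin n → ℝ) → ℝ} (hf : LogConcave f) :
    IsLogConcave f := by
  refine ⟨hf.1, fun x y a b ha hb hab => ?_⟩
  rcases (hf.1 x).eq_or_lt with hx | hx
  · rw [← hx, Real.zero_rpow ha.ne', zero_mul]
    exact hf.1 _
  rcases (hf.1 y).eq_or_lt with hy | hy
  · rw [← hy, Real.zero_rpow hb.ne', mul_zero]
    exact hf.1 _
  have hz : 0 < f (a • x + b • y) := hf.2.1 hx hy ha.le hb.le hab
  have h := hf.2.2 hx hy ha.le hb.le hab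
  have hxa := Real.rpow_pos_of_pos hx a
  have hyb := Real.rpow_pos_of_pos hy b
  rw [← Real.logb_le_logb one_lt_two (mul_pos hxa hyb) hz, Real.logb_mul hxa.ne' hyb.ne',
    Real.logb_rpow_eq_mul_logb_of_pos hx, Real.logb_rpow_eq_mul_logb_of_pos hy]
  exact h

theorem IsLogConcave.comp_linearMap {E F : Type*} [AddCommGroup E] [Module ℝ E] [AddCommGroup F]
    [Module ℝ F] {f : F → ℝ} (hf : IsLogConcave f) (L : E →ₗ[ℝ] F) :
    IsLogConcave fun x => f (L x) :=
  ⟨fun _ => hf.nonneg _, fun x y a b ha hb hab => by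
    simpa using hf.le_map (L x) (L y) a b ha hb hab⟩

theorem IsLogConcave.convex_superlevel {E : Type*} [AddCommGroup E] [Module ℝ E] {f : E → ℝ}
    (hf : IsLogConcave f) (u : ℝ) : Convex ℝ {x | u < f x} := by
  rcases lt_or_ge u 0 with hu | hu
  · convert convex_univ (𝕜 := ℝ) (E := E)
    exact eq_univ_of_forall fun x => hu.trans_le (hf.nonneg x)
  refine convex_iff_forall_pos.2 fun x hx y hy a b ha hb hab => ?_
  have hx : u < f x := hx
  have hy : u < f y := hy
  calc u = u ^ a * u ^ b := by
        rw [← Real.rpow_add' hu (by rw [hab]; norm_num), hab, Real.rpow_one]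
    _ < f x ^ a * f y ^ b := mul_lt_mul'' (Real.rpow_lt_rpow hu hx ha) (Real.rpow_lt_rpow hu hy hb)
        (by positivity) (by positivity)
    _ ≤ _ := hf.le_map x y a b ha hb hab

variable {E : Type*} [NormedAddCommGroup E] [NormedSpace ℝ E] [FiniteDimensional ℝ E]
  [MeasurableSpace E] [BorelSpace E] (μ : Measure E) [μ.IsAddHaarMeasure]

theorem lintegral_comp_smul_add (h : E → ℝ≥0∞) {t : ℝ} (ht : 0 < t) (w : E) :
    ∫⁻ x, h (t • x + w) ∂μ = ENNReal.ofReal ((t ^ finrank ℝ E)⁻¹) * ∫⁻ x, h x ∂μ := by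
  have h1 := (lintegral_map_equiv (μ := μ) (fun x => h (x + w))
    (Homeomorph.smulOfNeZero t ht.ne').toMeasurableEquiv)
  have h2 : Measure.map (Homeomorph.smulOfNeZero t ht.ne').toMeasurableEquiv μ
      = ENNReal.ofReal ((t ^ finrank ℝ E)⁻¹) • μ := by
    have := Measure.map_addHaar_smul μ ht.ne'
    rwa [abs_of_pos (by positivity)] at this
  rw [h2, lintegral_smul_measure, lintegral_add_right_eq_self] at h1
  exact h1.symm

/-- Integrate `f x ^ t * f x₀ ^ (1 - t) ≤ f (t • x + (1 - t) • x₀)` over `x` and rescale. Both the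
boundedness of `f` and its entropy bound come from this. -/
theorem IsLogConcave.lintegral_rpow_mul_le {f : E → ℝ} (hf : IsLogConcave f) {t : ℝ} (ht : 0 < t)
    (ht1 : t < 1) (x₀ : E) :
    ENNReal.ofReal (f x₀ ^ (1 - t)) * ∫⁻ x, ENNReal.ofReal (f x ^ t) ∂μ ≤
      ENNReal.ofReal ((t ^ finrank ℝ E)⁻¹) * ∫⁻ x, ENNReal.ofReal (f x) ∂μ := by
  rw [← lintegral_comp_smul_add μ (fun x => ENNReal.ofReal (f x)) ht ((1 - t) • x₀),
    ← lintegral_const_mul' _ _ (by simp)]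
  refine lintegral_mono fun x => ?_
  dsimp only
  rw [← ENNReal.ofReal_mul (Real.rpow_nonneg (hf.nonneg _) _), mul_comm]
  exact ENNReal.ofReal_le_ofReal (hf.le_map x x₀ t (1 - t) ht (by linarith) (by ring))

theorem IsLogConcave.aemeasurable {f : E → ℝ} (hf : IsLogConcave f) : AEMeasurable f μ :=
  aemeasurable_of_convex_superlevel μ hf.convex_superlevel

/-- At `t = 1 / 2` the previous inequality bounds `√(f x)` by a quotient independent of `x`, whose
denominator `∫ √f` is nonzero. -/
theorem IsLogConcave.bddAbove_range {f : E → ℝ} (hf : IsLogConcave f)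
    (h0 : ∫⁻ x, ENNReal.ofReal (f x) ∂μ ≠ 0) (htop : ∫⁻ x, ENNReal.ofReal (f x) ∂μ ≠ ∞) :
    BddAbove (range f) := by
  have hI : ∫⁻ x, ENNReal.ofReal (f x ^ (1 / 2 : ℝ)) ∂μ ≠ 0 := by
    intro h
    have hm := ((hf.aemeasurable μ).pow_const (1 / 2 : ℝ)).ennreal_ofReal
    rw [lintegral_eq_zero_iff' hm] at h
    apply h0
    rw [lintegral_eq_zero_iff' (hf.aemeasurable μ).ennreal_ofReal]
    filter_upwards [h] with x hx
    rw [Pi.zero_apply, ENNReal.ofReal_eq_zero] at hx ⊢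
    by_contra! hlt
    exact hx.not_gt (Real.rpow_pos_of_pos hlt _)
  set D := ENNReal.ofReal (((1 / 2 : ℝ) ^ finrank ℝ E)⁻¹) * ∫⁻ x, ENNReal.ofReal (f x) ∂μ with hD
  have hDtop : D ≠ ∞ := ENNReal.mul_ne_top (by simp) htop
  set I := ∫⁻ x, ENNReal.ofReal (f x ^ (1 / 2 : ℝ)) ∂μ
  have hDI : D / I ≠ ∞ := ENNReal.div_ne_top hDtop hI
  refine ⟨(D / I).toReal ^ 2, ?_⟩
  rintro _ ⟨x, rfl⟩
  have h := hf.lintegral_rpow_mul_le μ (t := 1 / 2) (by norm_num) (by norm_num) x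
  rw [show (1 - 1 / 2 : ℝ) = 1 / 2 by norm_num] at h
  have h2 : ENNReal.ofReal (f x ^ (1 / 2 : ℝ)) ≤ D / I :=
    (ENNReal.le_div_iff_mul_le (Or.inl hI) (Or.inr hDtop)).2 h
  rw [ENNReal.ofReal_le_iff_le_toReal hDI, ← Real.sqrt_eq_rpow] at h2
  exact (Real.sqrt_le_iff.1 h2).2

/-- The relative entropy bound `∫ f log (sup f / f) ≤ dim E` for a log-concave density `f`. -/
theorem IsLogConcave.lintegral_mul_log_le {f : E → ℝ} (hf : IsLogConcave f)
    (h1 : ∫⁻ x, ENNReal.ofReal (f x) ∂μ = 1) :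
    ∫⁻ x, ENNReal.ofReal (f x * Real.log ((⨆ z, f z) / f x)) ∂μ ≤ finrank ℝ E := by
  have hbdd := hf.bddAbove_range μ (by simp [h1]) (by simp [h1])
  set B := ⨆ z, f z with hB
  have hfB (x : E) : f x ≤ B := le_ciSup hbdd x
  have hB0 : 0 ≤ B := (hf.nonneg 0).trans (hfB 0)
  set L := ∫⁻ x, ENNReal.ofReal (f x * Real.log (B / f x)) ∂μ with hL
  have hlog (x : E) : 0 ≤ f x * Real.log (B / f x) := by
    rcases (hf.nonneg x).eq_or_lt with hx | hx
    · simp [← hx]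
    · exact mul_nonneg hx.le (Real.log_nonneg ((one_le_div hx).2 (hfB x)))
  -- Taking the supremum over `x₀` gives `∫ B ^ (1 - t) * f ^ t ≤ t ^ (-dim E)`. The integrand is `f
  -- * exp ((1 - t) * log (B / f))`, and `exp s ≥ 1 + s`.
  have step (t : ℝ) (ht : 0 < t) (ht1 : t < 1) :
      ENNReal.ofReal (1 - t) * L + 1 ≤ ENNReal.ofReal ((t ^ finrank ℝ E)⁻¹) := by
    set D := ENNReal.ofReal ((t ^ finrank ℝ E)⁻¹) with hD
    have hD0 : D ≠ 0 := by rw [hD, Ne, ENNReal.ofReal_eq_zero, not_le]; positivity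
    have hDtop : D ≠ ∞ := ENNReal.ofReal_ne_top
    have hsup : ENNReal.ofReal (B ^ (1 - t)) * ∫⁻ x, ENNReal.ofReal (f x ^ t) ∂μ ≤ D := by
      rw [← ENNReal.le_div_iff_mul_le (Or.inr hD0) (Or.inr hDtop)]
      have hcl : IsClosed {c : ℝ | ENNReal.ofReal (c ^ (1 - t)) ≤
          D / ∫⁻ x, ENNReal.ofReal (f x ^ t) ∂μ} :=
        isClosed_le (ENNReal.continuous_ofReal.comp
          (Real.continuous_rpow_const (by linarith))) continuous_const
      refine closure_minimal ?_ hcl (csSup_mem_closure (range_nonempty f) hbdd)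
      rintro _ ⟨x, rfl⟩
      rw [mem_ofPred_eq, ENNReal.le_div_iff_mul_le (Or.inr hD0) (Or.inr hDtop)]
      simpa [h1] using hf.lintegral_rpow_mul_le μ ht ht1 x
    refine le_trans ?_ hsup
    rw [hL, ← h1, ← lintegral_const_mul' _ _ (by simp), ← lintegral_const_mul' _ _ (by simp),
      ← lintegral_add_right' _ (hf.aemeasurable μ).ennreal_ofReal]
    refine lintegral_mono fun x => ?_
    dsimp only
    rw [← ENNReal.ofReal_mul (by linarith), ← ENNReal.ofReal_mul (by positivity),
      ← ENNReal.ofReal_add (mul_nonneg (by linarith) (hlog x)) (hf.nonneg x)]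
    refine ENNReal.ofReal_le_ofReal ?_
    rcases (hf.nonneg x).eq_or_lt with hx | hx
    · rw [← hx, Real.zero_rpow ht.ne']; simp
    have hBp : 0 < B := hx.trans_le (hfB x)
    have e1 : B ^ (1 - t) * f x ^ t = f x * Real.exp ((1 - t) * Real.log (B / f x)) := by
      rw [mul_comm (1 - t), ← Real.rpow_def_of_pos (by positivity), Real.div_rpow hB0 hx.le,
        Real.rpow_sub hx, Real.rpow_one]
      have := (Real.rpow_pos_of_pos hx t).ne'
      field_simp
    rw [e1]
    have := Real.add_one_le_exp ((1 - t) * Real.log (B / f x))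
    nlinarith
  have hLtop : L ≠ ∞ := by
    intro h
    have := step (1 / 2) (by norm_num) (by norm_num)
    rw [h, ENNReal.mul_top (by norm_num)] at this
    simp at this
  -- Bernoulli's inequality `1 - t ^ d ≤ d * (1 - t)` allows cancelling `1 - t`; the endpoint `t =
  -- 1` is then reached by closedness.
  have hreal (t : ℝ) (ht : t ∈ Ioo (0 : ℝ) 1) : t ^ finrank ℝ E * L.toReal ≤ finrank ℝ E := by
    have h := step t ht.1 ht.2
    have ht' : 0 < 1 - t := by linarith [ht.2]
    rw [← ENNReal.ofReal_toReal hLtop, ← ENNReal.ofReal_mul ht'.le, ← ENNReal.ofReal_one,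
      ← ENNReal.ofReal_add (by positivity) zero_le_one,
      ENNReal.ofReal_le_ofReal_iff (by have := ht.1; positivity)] at h
    have hp : 0 < t ^ finrank ℝ E := pow_pos ht.1 _
    have hb := one_add_mul_le_pow (a := t - 1) (by linarith [ht.1]) (finrank ℝ E)
    rw [add_sub_cancel] at hb
    have h3 : t ^ finrank ℝ E * ((1 - t) * L.toReal + 1) ≤ 1 := by
      calc _ ≤ t ^ finrank ℝ E * (t ^ finrank ℝ E)⁻¹ := by gcongr
        _ = 1 := mul_inv_cancel₀ hp.ne'
    have h4 : (1 - t) * (t ^ finrank ℝ E * L.toReal) ≤ (1 - t) * finrank ℝ E := by nlinarith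
    exact le_of_mul_le_mul_left h4 ht'
  have hcl : IsClosed {t : ℝ | t ^ finrank ℝ E * L.toReal ≤ finrank ℝ E} :=
    isClosed_le (by fun_prop) continuous_const
  have h1mem : (1 : ℝ) ∈ closure (Ioo (0 : ℝ) 1) := by
    rw [closure_Ioo zero_ne_one]; simp
  have : (1 : ℝ) ^ finrank ℝ E * L.toReal ≤ finrank ℝ E :=
    closure_minimal (t := {t : ℝ | t ^ finrank ℝ E * L.toReal ≤ finrank ℝ E}) hreal hcl h1mem
  rw [one_pow, one_mul] at this
  rw [← ENNReal.ofReal_toReal hLtop, ← ENNReal.ofReal_natCast]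
  exact ENNReal.ofReal_le_ofReal this

end LogConcaveFunctions

/-! ### Conditional entropy on a product space, in nats. -/

section ConditionalEntropy

theorem map_fst_withDensity_prod {α β : Type*} [MeasurableSpace α] [MeasurableSpace β]
    (μ : Measure α) (ν : Measure β) [SFinite μ] [SFinite ν] {h : α × β → ℝ≥0∞}
    (hh : AEMeasurable h (μ.prod ν)) :
    ((μ.prod ν).withDensity h).map Prod.fst = μ.withDensity fun x => ∫⁻ y, h (x, y) ∂ν := by
  ext s hs
  rw [Measure.map_apply measurable_fst hs, withDensity_apply _ (measurable_fst hs),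
    withDensity_apply _ hs, ← prod_univ, setLIntegral_prod _ hh.restrict]
  simp

theorem IsLogConcave.aemeasurable_iSup {E F : Type*} [NormedAddCommGroup E]
    [NormedSpace ℝ E] [FiniteDimensional ℝ E] [MeasurableSpace E] [BorelSpace E]
    [NormedAddCommGroup F] [NormedSpace ℝ F] (μ : Measure E) [μ.IsAddHaarMeasure] {g : E × F → ℝ}
    (hg : IsLogConcave g) (hbdd : BddAbove (range g)) : AEMeasurable (fun x => ⨆ y, g (x, y)) μ := by
  refine aemeasurable_of_convex_superlevel μ fun u => ?_
  have : {x | u < ⨆ y, g (x, y)} = Prod.fst '' {z | u < g z} := by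
    ext x
    have : BddAbove (range fun y => g (x, y)) :=
      hbdd.mono (by rintro _ ⟨y, rfl⟩; exact mem_range_self _)
    simp [lt_ciSup_iff this]
  rw [this]
  exact (hg.convex_superlevel u).linear_image (LinearMap.fst ℝ E F)

variable {E F : Type*} [NormedAddCommGroup E] [NormedSpace ℝ E] [FiniteDimensional ℝ E]
  [MeasurableSpace E] [BorelSpace E] [NormedAddCommGroup F] [NormedSpace ℝ F]
  [FiniteDimensional ℝ F] [MeasurableSpace F] [BorelSpace F]
  (μ : Measure E) [μ.IsAddHaarMeasure] (ν : Measure F) [ν.IsAddHaarMeasure]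

theorem isAddHaarMeasure_prod : (μ.prod ν).IsAddHaarMeasure := inferInstance

/-- The section suprema and the marginal of a log-concave density on a product space: the section
suprema have a finite positive integral, and the marginal is bounded by `choose * sup / ∫ sup`. -/
theorem IsLogConcave.integrable_iSup {g : E × F → ℝ} (hg : IsLogConcave g)
    (h1 : ∫⁻ z, ENNReal.ofReal (g z) ∂μ.prod ν = 1) :
    Integrable (fun x => ⨆ y, g (x, y)) μ ∧ 0 < ∫ x, ⨆ y, g (x, y) ∂μ ∧
      ∀ x, ∫⁻ y, ENNReal.ofReal (g (x, y)) ∂ν ≠ ∞ ∧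
        (∫ x, ⨆ y, g (x, y) ∂μ) * (∫⁻ y, ENNReal.ofReal (g (x, y)) ∂ν).toReal ≤
          Nat.choose (finrank ℝ E + finrank ℝ F) (finrank ℝ F) * ⨆ z, g z := by
  have hbdd := hg.bddAbove_range (μ.prod ν) (by simp [h1]) (by simp [h1])
  have hgm := (hg.aemeasurable (μ.prod ν)).ennreal_ofReal
  have hsec (x : E) : BddAbove (range fun y => g (x, y)) :=
    hbdd.mono (by rintro _ ⟨y, rfl⟩; exact mem_range_self _)
  have hB0 : 0 ≤ ⨆ z, g z := (hg.nonneg 0).trans (le_ciSup hbdd 0)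
  have hM0 (x : E) : 0 ≤ ⨆ y, g (x, y) := (hg.nonneg (x, 0)).trans (le_ciSup (hsec x) 0)
  have hMm := hg.aemeasurable_iSup μ hbdd
  have hRS := lintegral_iSup_mul_lintegral_section_le μ ν hg.convex_superlevel hg.nonneg
    (fun z => le_ciSup hbdd z)
  rw [h1] at hRS
  rw [lintegral_prod _ hgm] at h1
  -- Rogers–Shephard at one base point of nonzero marginal makes the integral of the fibre suprema
  -- finite. Once that integral is known to be nonzero, the same inequality makes every marginal
  -- value finite.
  obtain ⟨x₀, hx₀⟩ : ∃ x, ∫⁻ y, ENNReal.ofReal (g (x, y)) ∂ν ≠ 0 := by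
    by_contra! h
    simp [h] at h1
  have htop : ∫⁻ x, ENNReal.ofReal (⨆ y, g (x, y)) ∂μ ≠ ∞ :=
    (ENNReal.lt_top_of_mul_ne_top_left (ne_top_of_le_ne_top
      (by simp [ENNReal.mul_eq_top]) (hRS x₀)) hx₀).ne
  have hpos : ∫⁻ x, ENNReal.ofReal (⨆ y, g (x, y)) ∂μ ≠ 0 := by
    rw [Ne, lintegral_eq_zero_iff' hMm.ennreal_ofReal]
    intro h
    have : ∫⁻ x, ∫⁻ y, ENNReal.ofReal (g (x, y)) ∂ν ∂μ = 0 := by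
      rw [lintegral_congr_ae (g := 0)]
      · simp
      filter_upwards [h] with x hx
      have hy (y : F) : ENNReal.ofReal (g (x, y)) = 0 :=
        le_zero_iff.1 ((ENNReal.ofReal_le_ofReal (le_ciSup (hsec x) y)).trans hx.le)
      simp [hy]
    simp [this] at h1
  have hint : Integrable (fun x => ⨆ y, g (x, y)) μ :=
    ⟨hMm.aestronglyMeasurable,
      (hasFiniteIntegral_iff_ofReal (Filter.Eventually.of_forall hM0)).2 htop.lt_top⟩
  have hJ := ofReal_integral_eq_lintegral_ofReal hint (Filter.Eventually.of_forall hM0)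
  have hJpos : 0 < ∫ x, ⨆ y, g (x, y) ∂μ := by
    rw [← hJ, Ne, ENNReal.ofReal_eq_zero, not_le] at hpos
    exact hpos
  refine ⟨hint, hJpos, fun x => ?_⟩
  have hx := hRS x
  have hfin : ∫⁻ y, ENNReal.ofReal (g (x, y)) ∂ν ≠ ∞ := by
    rw [mul_comm] at hx
    exact (ENNReal.lt_top_of_mul_ne_top_left (ne_top_of_le_ne_top
      (by simp [ENNReal.mul_eq_top]) hx) hpos).ne
  refine ⟨hfin, ?_⟩
  rw [← hJ, mul_one] at hx
  have := ENNReal.toReal_mono (by simp [ENNReal.mul_eq_top]) hx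
  simpa [ENNReal.toReal_mul, ENNReal.toReal_ofReal hJpos.le, ENNReal.toReal_ofReal hB0] using this

/-- Bounds (in nats) for the conditional entropy of a log-concave density on a product space. -/
theorem IsLogConcave.condEntropy_bounds {g : E × F → ℝ} (hg : IsLogConcave g)
    (h1 : ∫⁻ z, ENNReal.ofReal (g z) ∂μ.prod ν = 1) :
    let Q := (μ.prod ν).withDensity fun z => ENNReal.ofReal (g z)
    let W := fun z : E × F => Real.log (g z / (∫⁻ y, ENNReal.ofReal (g (z.1, y)) ∂ν).toReal)
    let J := ∫ x, ⨆ y, g (x, y) ∂μ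
    Integrable W Q ∧ 0 ≤ (∫ z, -W z ∂Q) + Real.log J ∧
      (∫ z, -W z ∂Q) + Real.log J ≤ (finrank ℝ E + finrank ℝ F : ℕ) +
        Real.log (Nat.choose (finrank ℝ E + finrank ℝ F) (finrank ℝ F)) := by
  intro Q W J
  obtain ⟨hMint, hJ, hmarg⟩ := hg.integrable_iSup μ ν h1
  change 0 < J at hJ
  have hbdd := hg.bddAbove_range (μ.prod ν) (by simp [h1]) (by simp [h1])
  have hgm := hg.aemeasurable (μ.prod ν)
  have hsec (x : E) : BddAbove (range fun y => g (x, y)) :=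
    hbdd.mono (by rintro _ ⟨y, rfl⟩; exact mem_range_self _)
  set B := ⨆ z, g z with hB
  set M : E → ℝ := fun x => ⨆ y, g (x, y) with hM
  have hM0 (x : E) : 0 ≤ M x := (hg.nonneg (x, 0)).trans (le_ciSup (hsec x) 0)
  set G : E → ℝ≥0∞ := fun x => ∫⁻ y, ENNReal.ofReal (g (x, y)) ∂ν with hG
  have hGm : AEMeasurable G μ := hgm.ennreal_ofReal.lintegral_prod_right'
  generalize hC : ((Nat.choose (finrank ℝ E + finrank ℝ F) (finrank ℝ F) : ℕ) : ℝ) = C at hmarg ⊢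
  have hCpos : 0 < C := by
    rw [← hC]; exact_mod_cast Nat.choose_pos (Nat.le_add_left _ _)
  have hQac : Q ≪ μ.prod ν := withDensity_absolutelyContinuous _ _
  have hQfst : Q.map Prod.fst = μ.withDensity G := map_fst_withDensity_prod μ ν hgm.ennreal_ofReal
  have hQprob : IsProbabilityMeasure Q := ⟨by simp [Q, h1]⟩
  have hgpos : ∀ᵐ z ∂Q, 0 < g z := by
    rw [ae_withDensity_iff' hgm.ennreal_ofReal]
    refine Filter.Eventually.of_forall fun z hz => ?_
    rwa [Ne, ENNReal.ofReal_eq_zero, not_le] at hz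
  have hGpos : ∀ᵐ z ∂Q, 0 < (G z.1).toReal := by
    have : ∀ᵐ x ∂Q.map Prod.fst, 0 < (G x).toReal := by
      rw [hQfst, ae_withDensity_iff' hGm]
      exact Filter.Eventually.of_forall fun x hx => ENNReal.toReal_pos hx (hmarg x).1
    exact ae_of_ae_map measurable_fst.aemeasurable this
  -- the joint entropy
  let V₁ : E × F → ℝ := fun z => Real.log (B / g z)
  have hV₁m : AEMeasurable V₁ (μ.prod ν) := (hgm.const_div B).log
  have hV₁0 : ∀ᵐ z ∂Q, 0 ≤ V₁ z := by
    filter_upwards [hgpos] with z hz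
    exact Real.log_nonneg ((one_le_div hz).2 (le_ciSup hbdd z))
  have hV₁l : ∫⁻ z, ENNReal.ofReal (V₁ z) ∂Q ≤ (finrank ℝ E + finrank ℝ F : ℕ) := by
    rw [lintegral_withDensity_eq_lintegral_mul₀ hgm.ennreal_ofReal hV₁m.ennreal_ofReal]
    have := hg.lintegral_mul_log_le (μ.prod ν) h1
    rw [finrank_prod] at this
    convert this using 3 with z
    rw [Pi.mul_apply, ENNReal.ofReal_mul (hg.nonneg z)]
  have hV₁i : Integrable V₁ Q := ⟨(hV₁m.mono_ac hQac).aestronglyMeasurable,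
    (hasFiniteIntegral_iff_ofReal hV₁0).2 (hV₁l.trans_lt (by simp))⟩
  have hV₁ : ∫ z, V₁ z ∂Q ≤ (finrank ℝ E + finrank ℝ F : ℕ) := by
    rw [integral_eq_lintegral_of_nonneg_ae hV₁0 hV₁i.1]
    exact ENNReal.toReal_le_of_le_ofReal (by positivity)
      (by rwa [ENNReal.ofReal_natCast])
  -- the likelihood ratio of the normalized section suprema against the marginal
  let R : E → ℝ := fun x => M x / (G x).toReal
  let V₂ : E × F → ℝ := fun z => R z.1
  have hRm : AEMeasurable R μ := (hg.aemeasurable_iSup μ hbdd).div hGm.ennreal_toReal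
  have hR0 (x : E) : 0 ≤ R x := div_nonneg (hM0 x) ENNReal.toReal_nonneg
  have hRm' : AEMeasurable R (Q.map Prod.fst) := by
    rw [hQfst]
    exact hRm.mono_ac (withDensity_absolutelyContinuous _ _)
  have hV₂m : AEMeasurable V₂ Q := hRm'.comp_aemeasurable measurable_fst.aemeasurable
  have hV₂l : ∫⁻ z, ENNReal.ofReal (V₂ z) ∂Q ≤ ENNReal.ofReal J := by
    rw [← lintegral_map' (f := fun x => ENNReal.ofReal (R x)) hRm'.ennreal_ofReal
      measurable_fst.aemeasurable, hQfst,
      lintegral_withDensity_eq_lintegral_mul₀ hGm hRm.ennreal_ofReal,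
      ofReal_integral_eq_lintegral_ofReal hMint (Filter.Eventually.of_forall hM0)]
    refine lintegral_mono fun x => ?_
    have hGx : ENNReal.ofReal (G x).toReal = G x := ENNReal.ofReal_toReal (hmarg x).1
    rw [Pi.mul_apply, ← hGx, ← ENNReal.ofReal_mul (by simp)]
    refine ENNReal.ofReal_le_ofReal ?_
    -- `M` may be positive where the marginal vanishes; the quotient is `0` there by convention, so
    -- only an inequality with `J` holds.
    rcases eq_or_ne (G x).toReal 0 with h0 | h0
    · rw [h0, zero_mul]; exact hM0 x
    · exact (mul_div_cancel₀ (M x) h0).le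
  have hV₂0 : ∀ᵐ z ∂Q, 0 ≤ V₂ z := Filter.Eventually.of_forall fun z => hR0 _
  have hV₂i : Integrable V₂ Q := ⟨hV₂m.aestronglyMeasurable,
    (hasFiniteIntegral_iff_ofReal hV₂0).2 (hV₂l.trans_lt (by simp))⟩
  have hV₂ : ∫ z, V₂ z ∂Q ≤ J := by
    rw [integral_eq_lintegral_of_nonneg_ae hV₂0 hV₂i.1]
    exact ENNReal.toReal_le_of_le_ofReal hJ.le hV₂l
  -- From `g ≤ M` and `log s ≤ s - 1` at `s = R / J`.
  have hlow : ∀ᵐ z ∂Q, 1 - V₂ z / J - Real.log J ≤ -W z := by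
    filter_upwards [hgpos, hGpos] with z hz hGz
    have hMz : g z ≤ M z.1 := le_ciSup (hsec z.1) z.2
    have hMpos : 0 < M z.1 := hz.trans_le hMz
    have h2 : W z ≤ Real.log (R z.1) :=
      Real.log_le_log (div_pos hz hGz) (div_le_div_of_nonneg_right hMz hGz.le)
    have h3 := Real.log_le_sub_one_of_pos (x := R z.1 / J) (div_pos (div_pos hMpos hGz) hJ)
    rw [Real.log_div (div_pos hMpos hGz).ne' hJ.ne'] at h3
    change 1 - R z.1 / J - Real.log J ≤ -W z
    linarith
  -- The logarithm of `J * G ≤ C * B`. Together with `hlow` it sandwiches `-W` between integrable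
  -- functions, which also yields absolute convergence.
  have hupp : ∀ᵐ z ∂Q, -W z ≤ V₁ z + (Real.log C - Real.log J) := by
    filter_upwards [hgpos, hGpos] with z hz hGz
    have hBpos : 0 < B := hz.trans_le (le_ciSup hbdd z)
    have h2 := Real.log_le_log (mul_pos hJ hGz) (hmarg z.1).2
    rw [Real.log_mul hJ.ne' hGz.ne', Real.log_mul hCpos.ne' hBpos.ne'] at h2
    simp only [V₁, W]
    rw [Real.log_div hz.ne' hGz.ne', Real.log_div hBpos.ne' hz.ne']
    linarith
  have hWm : AEMeasurable W Q := by
    have : AEMeasurable (fun z : E × F => (G z.1).toReal) (μ.prod ν) :=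
      hGm.ennreal_toReal.comp_quasiMeasurePreserving Measure.quasiMeasurePreserving_fst
    exact (hgm.div this).log.mono_ac hQac
  have hli : Integrable (fun z => 1 - V₂ z / J - Real.log J) Q :=
    ((integrable_const _).sub (hV₂i.div_const _)).sub (integrable_const _)
  have hui : Integrable (fun z => V₁ z + (Real.log C - Real.log J)) Q :=
    hV₁i.add (integrable_const _)
  have hWi : Integrable (fun z => -W z) Q :=
    integrable_of_le_of_le hWm.neg.aestronglyMeasurable hlow hupp hli hui
  refine ⟨by simpa using hWi.neg, ?_, ?_⟩
  · have := integral_mono_ae hli hWi hlow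
    have hdi : Integrable (fun z => 1 - V₂ z / J) Q := (integrable_const _).sub (hV₂i.div_const _)
    rw [integral_sub hdi (integrable_const _),
      integral_sub (integrable_const _) (hV₂i.div_const _), integral_div] at this
    simp only [integral_const, probReal_univ, one_smul] at this
    have : (∫ z, V₂ z ∂Q) / J ≤ 1 := (div_le_one hJ).2 hV₂
    linarith
  · have := integral_mono_ae hWi hui hupp
    rw [integral_add hV₁i (integrable_const _)] at this
    simp only [integral_const, probReal_univ, one_smul] at this
    linarith

/-! ### Splitting coordinates, and the law of the random vector. -/

theorem measurePreserving_head_tail {m n : ℕ} (h : m ≤ n) :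
    MeasurePreserving (fun x : Fin n → ℝ => (head h x, tail m x)) := by
  let e : Fin m ⊕ Fin (n - m) ≃ Fin n := finSumFinEquiv.trans (finCongr (by omega))
  exact (volume_measurePreserving_sumPiEquivProdPi fun _ => ℝ).comp
    (volume_measurePreserving_piCongrLeft (fun _ => ℝ) e).symm

theorem join_head_tail {m n : ℕ} (h : m ≤ n) (x : Fin n → ℝ) : join (head h x) (tail m x) = x := by
  ext i
  unfold join head tail
  split_ifs with hi
  · rfl
  · congr 1; ext; simp; omega

/-- `join` as a linear map. -/
def joinLinearMap (m n : ℕ) : (Fin m → ℝ) × (Fin (n - m) → ℝ) →ₗ[ℝ] (Fin n → ℝ) where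
  toFun z := join z.1 z.2
  map_add' z w := by
    ext i; simp only [join, Prod.fst_add, Prod.snd_add, Pi.add_apply]; split_ifs <;> rfl
  map_smul' c z := by
    ext i; simp only [join, Prod.smul_fst, Prod.smul_snd, Pi.smul_apply]; split_ifs <;> rfl

theorem IsPDFOf.map_head_tail {Ω : Type*} [MeasurableSpace Ω] {P : Measure Ω} {n m : ℕ}
    (hmn : m ≤ n) {X : Ω → Fin n → ℝ} {f : (Fin n → ℝ) → ℝ} (hX : IsPDFOf f X P)
    (hg : AEMeasurable (fun z : (Fin m → ℝ) × (Fin (n - m) → ℝ) => f (join z.1 z.2)) volume) :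
    P.map (fun ω => (head hmn (X ω), tail m (X ω))) =
      volume.withDensity fun z => ENNReal.ofReal (f (join z.1 z.2)) := by
  have hmp := measurePreserving_head_tail hmn
  have hcomp : P.map (fun ω => (head hmn (X ω), tail m (X ω)))
      = (P.map X).map fun x => (head hmn x, tail m x) :=
    (AEMeasurable.map_map_of_aemeasurable hmp.measurable.aemeasurable
      hX.aemeasurable_vector).symm
  rw [hcomp, hX.map_eq]
  ext s hs
  rw [Measure.map_apply hmp.measurable hs, withDensity_apply _ (hmp.measurable hs),
    withDensity_apply _ hs, ← lintegral_indicator hs, ← lintegral_indicator (hmp.measurable hs),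
    ← hmp.map_eq, lintegral_map' _ hmp.measurable.aemeasurable]
  · refine lintegral_congr fun x => ?_
    rw [indicator, indicator]
    simp only [join_head_tail]
    rfl
  · rw [hmp.map_eq]
    exact hg.ennreal_ofReal.indicator hs

/-- `pdf` is a Radon–Nikodym derivative, determined only `μ`-almost everywhere. The law of `Y` is
absolutely continuous, so evaluating at `Y ω` loses only a `P`-null set. -/
theorem pdf_ae_eq_of_map_eq_withDensity {Ω α : Type*} [MeasurableSpace Ω] [MeasurableSpace α]
    {P : Measure Ω} {μ : Measure α} [SigmaFinite μ] {Y : Ω → α} {h : α → ℝ≥0∞}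
    (hY : AEMeasurable Y P) (hh : AEMeasurable h μ) (hmap : P.map Y = μ.withDensity h) :
    ∀ᵐ ω ∂P, pdf Y P μ (Y ω) = h (Y ω) := by
  refine ae_of_ae_map hY (p := fun y => pdf Y P μ y = h y) ?_
  rw [hmap]
  refine (withDensity_absolutelyContinuous μ h).ae_le ?_
  rw [pdf_def, hmap]
  exact Measure.rnDeriv_withDensity₀ μ hh

end ConditionalEntropy

end LogConcaveEntropy

/-! ### The theorem for the random vector, in bits. -/

open Set Module LogConcaveEntropy in
theorem lemma3 {Ω : Type*} [MeasurableSpace Ω] (P : MeasureTheory.Measure Ω)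
    [MeasureTheory.IsProbabilityMeasure P] (n m : ℕ) (hm : 1 ≤ m) (hmn : m ≤ n)
    (X : Ω → Fin n → ℝ) (f : (Fin n → ℝ) → ℝ)
    (hX : LogConcaveEntropy.IsPDFOf f X P) (hf : LogConcaveEntropy.LogConcave f) :
    -- all the quantities involved are well defined and finite
    BddAbove (Set.range f) ∧
    MeasureTheory.Integrable (LogConcaveEntropy.supMarginal m f) MeasureTheory.volume ∧
    0 < ∫ x, LogConcaveEntropy.supMarginal m f x ∧
    MeasureTheory.Integrable (fun ω => Real.logb 2
      (LogConcaveEntropy.condDensity (fun ω => LogConcaveEntropy.tail m (X ω))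
        (fun ω => LogConcaveEntropy.head hmn (X ω)) P
        (LogConcaveEntropy.tail m (X ω)) (LogConcaveEntropy.head hmn (X ω)))) P ∧
    -- the two inequalities
    0 ≤ LogConcaveEntropy.condDiffEntropy (fun ω => LogConcaveEntropy.tail m (X ω))
          (fun ω => LogConcaveEntropy.head hmn (X ω)) P
        + Real.logb 2 (∫ x, LogConcaveEntropy.supMarginal m f x) ∧
    LogConcaveEntropy.condDiffEntropy (fun ω => LogConcaveEntropy.tail m (X ω))
          (fun ω => LogConcaveEntropy.head hmn (X ω)) P
        + Real.logb 2 (∫ x, LogConcaveEntropy.supMarginal m f x)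
      ≤ n * Real.logb 2 (Real.exp 1) + Real.logb 2 (n.choose m) := by
  let g : (Fin m → ℝ) × (Fin (n - m) → ℝ) → ℝ := fun z => f (join z.1 z.2)
  have hg : IsLogConcave g := hf.isLogConcave.comp_linearMap (joinLinearMap m n)
  have hvol : ((volume : Measure (Fin m → ℝ)).prod
      (volume : Measure (Fin (n - m) → ℝ))).IsAddHaarMeasure :=
    isAddHaarMeasure_prod volume volume
  have hgm : AEMeasurable g volume := hg.aemeasurable (volume.prod volume)
  let Z : Ω → (Fin m → ℝ) × (Fin (n - m) → ℝ) := fun ω => (head hmn (X ω), tail m (X ω))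
  have hZm : AEMeasurable Z P :=
    (measurePreserving_head_tail hmn).measurable.comp_aemeasurable hX.aemeasurable_vector
  have hZ : P.map Z = volume.withDensity fun z => ENNReal.ofReal (g z) :=
    hX.map_head_tail hmn hgm
  have h1 : ∫⁻ z, ENNReal.ofReal (g z) = 1 := by
    have := congrArg (fun Q => Q univ) hZ
    simpa [Measure.map_apply_of_aemeasurable hZm] using this.symm
  have hhead : P.map (fun ω => head hmn (X ω)) =
      volume.withDensity fun x => ∫⁻ y, ENNReal.ofReal (g (x, y)) := by
    rw [← map_fst_withDensity_prod volume volume hgm.ennreal_ofReal, ← Measure.volume_eq_prod, ← hZ,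
      AEMeasurable.map_map_of_aemeasurable measurable_fst.aemeasurable hZm]
    rfl
  have hbdd : BddAbove (range f) := by
    refine (hg.bddAbove_range (volume.prod volume) (by simp [← Measure.volume_eq_prod, h1])
      (by simp [← Measure.volume_eq_prod, h1])).mono ?_
    rintro _ ⟨x, rfl⟩
    exact ⟨(head hmn x, tail m x), congrArg f (join_head_tail hmn x)⟩
  obtain ⟨hMint, hJ, -⟩ := hg.integrable_iSup volume volume h1
  obtain ⟨hWi, hlow, hupp⟩ := hg.condEntropy_bounds volume volume h1
  rw [← Measure.volume_eq_prod, ← hZ] at hWi hlow hupp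
  set W : (Fin m → ℝ) × (Fin (n - m) → ℝ) → ℝ :=
    fun z => Real.log (g z / (∫⁻ y, ENNReal.ofReal (g (z.1, y))).toReal) with hW
  have hcond : ∀ᵐ ω ∂P, Real.logb 2 (condDensity (fun ω => tail m (X ω))
      (fun ω => head hmn (X ω)) P (tail m (X ω)) (head hmn (X ω))) = W (Z ω) / Real.log 2 := by
    filter_upwards [pdf_ae_eq_of_map_eq_withDensity hZm hgm.ennreal_ofReal hZ,
      pdf_ae_eq_of_map_eq_withDensity hZm.fst
        hgm.ennreal_ofReal.lintegral_prod_right' hhead] with ω h2 h3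
    simp only [condDensity, Real.logb, hW]
    congr 2
    congr 1
    · exact (congrArg ENNReal.toReal h2).trans (ENNReal.toReal_ofReal (hg.nonneg _))
    · exact congrArg ENNReal.toReal h3
  have hWZ : Integrable (fun ω => W (Z ω)) P := hWi.comp_aemeasurable hZm
  have hent : condDiffEntropy (fun ω => tail m (X ω)) (fun ω => head hmn (X ω)) P
      = (∫ z, -W z ∂P.map Z) / Real.log 2 := by
    rw [integral_map (f := fun z => -W z) hZm hWi.neg.1, ← integral_div]
    refine integral_congr_ae ?_
    filter_upwards [hcond] with ω hω
    rw [hω, neg_div]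
  have hlog2 : 0 < Real.log 2 := Real.log_pos one_lt_two
  rw [hent]
  refine ⟨hbdd, hMint, hJ, (hWZ.div_const _).congr (hcond.mono fun ω hω => hω.symm), ?_, ?_⟩
  · rw [Real.logb, ← add_div]
    exact div_nonneg hlow hlog2.le
  -- Dividing by `log 2` turns nats into bits. The product-space bound carries `choose n (n - m)`,
  -- which symmetry turns into `choose n m`.
  · rw [Real.logb, Real.logb, Real.logb, Real.log_exp, ← add_div, mul_one_div, ← add_div]
    refine div_le_div_of_nonneg_right (hupp.trans_eq ?_) hlog2.le
    simp only [finrank_fintype_fun_eq_card, Fintype.card_fin]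
    rw [Nat.add_sub_cancel' hmn, Nat.choose_symm hmn]
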